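/- **Setting.** Let $\mathcal L$ be a first-order language with a binary function symbol $\cdot$ (for instance any expansion of the language of groups). Let $\mathcal L^+$ be the expansion of $\mathcal L$ by a relation symbol $[\mu_\theta\le q](\bar z)$ for every $\mathcal L$-formula $\theta(\bar x;\bar z)$ and every $q\in\mathbb Q$; in a finite $\mathcal L$-structure $A$ it is interpreted as "$|\theta(A^{\bar x};\bar z)|/|A^{\bar x}|\le q$". Let $(A_i)_{i\in I}$ be finite groups expanded to $\mathcal L$-structures in which $\cdot$ is the group operation, and let the $\mathcal L^+$-structure $G$ be an elementary extension of an ultraproduct of the (canonically expanded) $A_i$; $G$ is a group under $\cdot$. Formulas are $\mathcal L$-formulas with parameters from $G$. For $\varphi(x)=\theta(x;\bar b)$ with $\theta$ an $\mathcal L$-formula and $\bar b$ in $G$, the pseudofinite counting measure is $\mu(\varphi)=\inf\{q\in\mathbb Q: G\models[\mu_\theta\le q](\bar b)\}$. A formula $\varphi(\bar x;\bar y)$ is *NIP* if for some $k\ge1$ there are no tuples $(\bar a_i)_{i\in[k]}$, $(\bar b_X)_{X\subseteq[k]}$ from $G$ such that for all $i,X$: $G\models\varphi(\bar a_i;\bar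 b_X)$ iff $i\in X$. A formula $\varphi(x)$ is *left (right) generic* if $G$ is a union of finitely many left (right) translates of $\varphi(G)$. Given $\varphi(x)$, put $\varphi^\ell(x;y):=\varphi(y\cdot x)$; given $\delta(x;\bar y)$, put $\delta^r(x;\bar y,u):=\delta(x\cdot u;\bar y)$. The formula $\delta(x;\bar y)$ is *invariant* if for all $a,\bar b$ in $G$ there is $\bar c$ in $G$ such that $\delta(a\cdot x;\bar b)$ is equivalent to $\delta(x;\bar c)$. An *instance* of $\delta$ is a formula $\delta(x;\bar b)$ or $\neg\delta(x;\bar b)$, a *$\delta$-formula* is a finite Boolean combination of instances, and $S_\delta(G)$ is the set of complete $\delta$-types over $G$, i.e. maximal consistent sets of instances of $\delta$ (up to equivalence in $G$); a $\delta$-formula belongs to $p\in S_\delta(G)$ if it is implied by finitely many members of $p$. A type $p\in S_\delta(G)$ is *left (right) generic* if every $\delta$-formula in $p$ is left (right) generic. For $g\in G$ put $gp=\{\varphi(g^{-1}x):\varphi(x)\in p\}$ and $pg=\{\varphi(xg^{-1}):\varphi(x)\in p\}$. **Statement.** 1. Let $\varphi(x)$ be a formula such that $\varphi^\ell(x;y)$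 is NIP. Then $\varphi(x)$ is left generic iff it is right generic iff $\mu(\varphi(x))>0$. 2. Let $\delta(x;\bar y)$ be an invariant NIP formula. - (a) If $\varphi(x)$ is a $\delta^r$-formula, then $\varphi^\ell(x;y)$ is NIP; consequently $\varphi(x)$ is left generic iff it is right generic iff $\mu(\varphi(x))>0$. - (b) For every $p\in S_{\delta^r}(G)$ the following are equivalent: (i) $p$ is left generic; (ii) $p$ is right generic; (iii) $\mu(\varphi(x))>0$ for every $\delta^r$-formula $\varphi(x)\in p$. - (c) There is a generic type in $S_{\delta^r}(G)$, and there is a type in $S_\delta(G)$ that is both left and right generic. If $p\in S_{\delta^r}(G)$ is generic and $g\in G$, then $gp$ and $pg$ are generic types in $S_{\delta^r}(G)$. (By (b), "generic" may be read as left or as right generic for $\delta^r$-types.) -/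

import Mathlib

open FirstOrder

namespace PseudofiniteNIP

open FirstOrder.Language FirstOrder.Language.Structure

universe u v w w' w''

/-! ### Formulas with parameters -/

/-- A formula with parameters from `G` in the variables `α`: an `L`-formula `θ(x̄; z̄)` together
with a tuple `z̄ = par` of elements of `G`. -/
structure ParamFormula (L : FirstOrder.Language.{u, v}) (G : Type w) (α : Type) where
  /-- number of parameters -/
  n : ℕ
  /-- the underlying `L`-formula -/
  form : L.Formula (α ⊕ Fin n)
  /-- the parameters -/
  par : Fin n → G

namespace ParamFormula

variable {L : FirstOrder.Language.{u, v}} {G : Type w} {α β : Type}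

/-- Satisfaction in `G`. -/
def Holds [L.Structure G] (φ : ParamFormula L G α) (a : α → G) : Prop :=
  φ.form.Realize (Sum.elim a φ.par)

/-- The subset `φ(G)` of `G` defined by a formula `φ(x)` in one variable. -/
def set [L.Structure G] (φ : ParamFormula L G (Fin 1)) : Set G :=
  {g | φ.Holds fun _ => g}

/-- `¬ φ`. -/
def neg (φ : ParamFormula L G α) : ParamFormula L G α :=
  ⟨φ.n, φ.form.not, φ.par⟩

/-- `φ ∧ ψ`; the two parameter tuples are concatenated. -/
def conj (φ ψ : ParamFormula L G α) : ParamFormula L G α :=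
  ⟨φ.n + ψ.n,
    φ.form.relabel (Sum.map id (Fin.castAdd ψ.n)) ⊓ ψ.form.relabel (Sum.map id (Fin.natAdd φ.n)),
    Fin.append φ.par ψ.par⟩

/-- `φ ∨ ψ`. -/
def disj (φ ψ : ParamFormula L G α) : ParamFormula L G α :=
  ⟨φ.n + ψ.n,
    φ.form.relabel (Sum.map id (Fin.castAdd ψ.n)) ⊔ ψ.form.relabel (Sum.map id (Fin.natAdd φ.n)),
    Fin.append φ.par ψ.par⟩

/-- For `δ(x; ȳ)` and a tuple `b̄` from `G`, the formula `δ(x; b̄)`. -/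
def inst {k : ℕ} (δ : ParamFormula L G (α ⊕ Fin k)) (b : Fin k → G) : ParamFormula L G α :=
  ⟨k + δ.n,
    δ.form.relabel
      (Sum.elim (Sum.map id (Fin.castAdd δ.n)) (fun j => Sum.inr (Fin.natAdd k j))),
    Fin.append b δ.par⟩

/-- For `φ(x)`, the formula `φˡ(x; y) := φ(y · x)`. -/
def left (mulSym : L.Functions 2) (φ : ParamFormula L G (Fin 1)) :
    ParamFormula L G (Fin 1 ⊕ Fin 1) :=
  ⟨φ.n,
    φ.form.subst
      (Sum.elim
        (fun _ => mulSym.apply₂ (Term.var (Sum.inl (Sum.inr 0))) (Term.var (Sum.inl (Sum.inl 0))))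
        (fun j => Term.var (Sum.inr j))),
    φ.par⟩

/-- For `δ(x; ȳ)`, the formula `δʳ(x; ȳ, u) := δ(x · u; ȳ)`; `u` is the last parameter variable. -/
def right (mulSym : L.Functions 2) {k : ℕ} (δ : ParamFormula L G (Fin 1 ⊕ Fin k)) :
    ParamFormula L G (Fin 1 ⊕ Fin (k + 1)) :=
  ⟨δ.n,
    δ.form.subst
      (Sum.elim
        (Sum.elim
          (fun _ => mulSym.apply₂ (Term.var (Sum.inl (Sum.inl 0)))
            (Term.var (Sum.inl (Sum.inr (Fin.last k)))))
          (fun j => Term.var (Sum.inl (Sum.inr j.castSucc))))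
        (fun j => Term.var (Sum.inr j))),
    δ.par⟩

/-- `φ(x̄; ȳ)` is `k`-NIP. -/
def IsKNIP [L.Structure G] (k : ℕ) (φ : ParamFormula L G (α ⊕ β)) : Prop :=
  ¬ ∃ (a : Fin k → α → G) (b : Set (Fin k) → β → G),
    ∀ i X, φ.Holds (Sum.elim (a i) (b X)) ↔ i ∈ X

/-- `φ(x̄; ȳ)` is NIP. -/
def IsNIP [L.Structure G] (φ : ParamFormula L G (α ⊕ β)) : Prop :=
  ∃ k, 1 ≤ k ∧ φ.IsKNIP k

/-- `δ(x; ȳ)` is (left) invariant: each `δ(a · x; b̄)` is equivalent to some `δ(x; c̄)`. -/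
def IsLeftInvariant [Group G] [L.Structure G] {k : ℕ} (δ : ParamFormula L G (Fin 1 ⊕ Fin k)) :
    Prop :=
  ∀ (a : G) (b : Fin k → G), ∃ c : Fin k → G, ∀ x : G,
    δ.Holds (Sum.elim (fun _ => a * x) b) ↔ δ.Holds (Sum.elim (fun _ => x) c)

/-- The `δ`-formulas: finite Boolean combinations of formulas `δ(x; b̄)`. -/
inductive IsDeltaFormula {k : ℕ} (δ : ParamFormula L G (Fin 1 ⊕ Fin k)) :
    ParamFormula L G (Fin 1) → Prop
  | inst (b : Fin k → G) : IsDeltaFormula δ (δ.inst b)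
  | neg {φ : ParamFormula L G (Fin 1)} : IsDeltaFormula δ φ → IsDeltaFormula δ φ.neg
  | conj {φ ψ : ParamFormula L G (Fin 1)} :
      IsDeltaFormula δ φ → IsDeltaFormula δ ψ → IsDeltaFormula δ (φ.conj ψ)
  | disj {φ ψ : ParamFormula L G (Fin 1)} :
      IsDeltaFormula δ φ → IsDeltaFormula δ ψ → IsDeltaFormula δ (φ.disj ψ)

end ParamFormula

/-! ### Pseudofinite structures and the pseudofinite counting measure -/

/-- The language with, for each `L`-formula `φ(x̄; ȳ)` and each rational `q`, a relation symbol
`[μ_φ ≤ q](ȳ)`. -/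
def countLang (L : FirstOrder.Language.{u, v}) : FirstOrder.Language.{0, max u v} :=
  ⟨fun _ => Empty, fun n => (Σ m : ℕ, L.Formula (Fin m ⊕ Fin n)) × ℚ⟩

/-- The expansion `L⁺` of `L` in which counting measures are visible. -/
abbrev plusLang (L : FirstOrder.Language.{u, v}) : FirstOrder.Language.{u, max u v} :=
  L.sum (countLang L)

/-- In a finite structure `A`, the symbol `[μ_φ ≤ q](ȳ)` says that the normalized counting measure
of `φ(A^x̄; ȳ)` is at most `q`. -/
@[reducible]
def countStructure (L : FirstOrder.Language.{u, v}) (A : Type w) [L.Structure A] :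
    (countLang L).Structure A where
  funMap := fun f => f.elim
  RelMap := fun R b =>
    (Nat.card {a : Fin R.1.1 → A // R.1.2.Realize (Sum.elim a b)} : ℚ) /
      (Nat.card (Fin R.1.1 → A) : ℚ) ≤ R.2

/-- The `L⁺`-structure `G` is (up to isomorphism) an elementary extension of the ultraproduct along
`U` of the canonical `L⁺`-expansions of the `L`-structures `A i`. -/
def IsElementaryExtensionOfUltraproduct (L : FirstOrder.Language.{u, v}) {ι : Type w}
    (U : Ultrafilter ι) (A : ι → Type w') [∀ i, L.Structure (A i)]
    (G : Type w'') [L.Structure G] [(countLang L).Structure G] : Prop :=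
  letI : ∀ i, (countLang L).Structure (A i) := fun i => countStructure L (A i)
  Nonempty (((U : Filter ι).Product A) ↪ₑ[plusLang L] G)

/-- The symbol `mulSym` is interpreted as the group operation. -/
def InterpretsMul {L : FirstOrder.Language.{u, v}} (mulSym : L.Functions 2) (A : Type w) [Group A]
    [L.Structure A] : Prop :=
  ∀ a b : A, funMap mulSym ![a, b] = a * b

/-- The pseudofinite counting measure of `φ(x̄) = θ(x̄; b̄)`: the standard part of `μ_θ(b̄)`, that
is, the infimum of the rationals `q` with `G ⊨ [μ_θ ≤ q](b̄)`. -/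
noncomputable def mu {L : FirstOrder.Language.{u, v}} {G : Type w} [(countLang L).Structure G]
    {m : ℕ} (φ : ParamFormula L G (Fin m)) : ℝ :=
  sInf {r : ℝ | ∃ q : ℚ, r = q ∧
    RelMap (L := countLang L) (M := G) (n := φ.n) (⟨m, φ.form⟩, q) φ.par}

/-! ### Generic sets -/

section Generic

variable {G : Type w} [Group G]

/-- `n` left translates of `A` cover `G`. -/
def IsLeftNGeneric (n : ℕ) (A : Set G) : Prop :=
  ∃ g : Fin n → G, ⋃ i, (fun x => g i * x) '' A = Set.univ

/-- `n` right translates of `A` cover `G`. -/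
def IsRightNGeneric (n : ℕ) (A : Set G) : Prop :=
  ∃ g : Fin n → G, ⋃ i, (fun x => x * g i) '' A = Set.univ

/-- Left generic sets. -/
def IsLeftGeneric (A : Set G) : Prop := ∃ n, 1 ≤ n ∧ IsLeftNGeneric n A

/-- Right generic sets. -/
def IsRightGeneric (A : Set G) : Prop := ∃ n, 1 ≤ n ∧ IsRightNGeneric n A

end Generic

/-! ### Complete `δ`-types over `G`

Formulas in a type are taken up to equivalence in `G`, so a type is a family of subsets of `G`. -/

section Types

variable {L : FirstOrder.Language.{u, v}} {G : Type w} [L.Structure G] {k : ℕ}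

/-- `X` is defined by an instance `δ(x; b̄)` or `¬ δ(x; b̄)`. -/
def IsInstanceSet (δ : ParamFormula L G (Fin 1 ⊕ Fin k)) (X : Set G) : Prop :=
  ∃ b : Fin k → G, X = (δ.inst b).set ∨ X = (δ.inst b).neg.set

/-- Consistency over `G`, i.e. finite satisfiability in `G`. -/
def IsConsistent (p : Set (Set G)) : Prop :=
  ∀ s ⊆ p, s.Finite → (⋂₀ s).Nonempty

/-- The space `S_δ(G)` of complete `δ`-types over `G`: maximal consistent sets of instances. -/
def typeSpace (δ : ParamFormula L G (Fin 1 ⊕ Fin k)) : Set (Set (Set G)) :=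
  {p | Maximal (fun q : Set (Set G) => (∀ X ∈ q, IsInstanceSet δ X) ∧ IsConsistent q) p}

/-- The formula `φ(x)` belongs to the type `p`, i.e. finitely many members of `p` imply it. (For
complete `p` and `φ` an instance, this just says that `φ(G)` is a member of `p`.) -/
def InType (φ : ParamFormula L G (Fin 1)) (p : Set (Set G)) : Prop :=
  ∃ s ⊆ p, s.Finite ∧ ⋂₀ s ⊆ φ.set

variable [Group G]

/-- A `δ`-type is left generic if every `δ`-formula in it is. -/
def IsLeftGenericType (δ : ParamFormula L G (Fin 1 ⊕ Fin k)) (p : Set (Set G)) : Prop :=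
  ∀ φ, δ.IsDeltaFormula φ → InType φ p → IsLeftGeneric φ.set

/-- A `δ`-type is right generic if every `δ`-formula in it is. -/
def IsRightGenericType (δ : ParamFormula L G (Fin 1 ⊕ Fin k)) (p : Set (Set G)) : Prop :=
  ∀ φ, δ.IsDeltaFormula φ → InType φ p → IsRightGeneric φ.set

end Types

section Translates

variable {G : Type w} [Group G]

/-- `gp = {φ(g⁻¹ x) : φ(x) ∈ p}`. -/
def leftTranslate (g : G) (p : Set (Set G)) : Set (Set G) :=
  (fun X => {x | g⁻¹ * x ∈ X}) '' p

/-- `pg = {φ(x g⁻¹) : φ(x) ∈ p}`. -/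
def rightTranslate (p : Set (Set G)) (g : G) : Set (Set G) :=
  (fun X => {x | x * g⁻¹ ∈ X}) '' p

end Translates

end PseudofiniteNIP

open PseudofiniteNIP

/-!
If `φ(y · x)` is NIP, its instances `φ(b · x)` all have the measure of `φ(x)`, since translations
are bijections of the finite groups `Aᵢ`. In a finite structure a `k`-NIP relation all of whose
fibres have density at least `1 / s` admits a net whose size depends only on `k` and `s`: by the
Sauer–Shelah lemma few subsets of a random sample are traces of fibres, and a random swap of the
two halves of the sample rarely puts many hits of a trace into the second half and none into the
first. This is a first-order statement in `L⁺`, so it holds in `G`, where a net `a₁, …, a_N` for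
`φ(y · x)` satisfies `G = ⋃ᵢ φ(G) aᵢ⁻¹`. Thus positive measure implies right genericity,
exchanging `x` and `y` gives left genericity, and conversely finitely many translates of a null
set cannot cover `G`, because `μ` is finitely subadditive and `μ(G) = 1`.

The complete `δ`-types over `G` are the traces on the instances of `δ` of the ultrafilters on `G`.
By subadditivity the complements of the null definable sets generate a proper filter; any
ultrafilter extending it induces generic types. Translating an ultrafilter translates its type.
-/

namespace PseudofiniteNIP

open FirstOrder.Language FirstOrder.Language.Structure

universe u v w w' w''

section NIPRelations

variable {α β : Type*} {R S : α → β → Prop} {k : ℕ}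

/-- The relation `R` is `k`-NIP: no `k` points are shattered by the family of sets `R · b`. This
is `ParamFormula.IsKNIP` with the formula replaced by the relation it defines. -/
def IsKNIPRel (k : ℕ) (R : α → β → Prop) : Prop :=
  ¬ ∃ (a : Fin k → α) (b : Set (Fin k) → β), ∀ i X, R (a i) (b X) ↔ i ∈ X

/-- The relation `R` is NIP; compare `ParamFormula.IsNIP`. -/
def IsNIPRel (R : α → β → Prop) : Prop :=
  ∃ k, 1 ≤ k ∧ IsKNIPRel k R

theorem IsKNIPRel.comap {α' β' : Type*} (h : IsKNIPRel k R) (f : α' → α) (g : β' → β) :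
    IsKNIPRel k fun a b => R (f a) (g b) :=
  fun ⟨a, b, hab⟩ => h ⟨f ∘ a, g ∘ b, hab⟩

theorem IsKNIPRel.not (h : IsKNIPRel k R) : IsKNIPRel k fun a b => ¬ R a b := by
  rintro ⟨a, b, hab⟩
  refine h ⟨a, fun X => b Xᶜ, fun i X => ?_⟩
  simpa [not_iff_comm] using (hab i Xᶜ).not

theorem IsKNIPRel.flip (h : IsKNIPRel k R) : IsKNIPRel (2 ^ k) (flip R) := by
  rintro ⟨b, a, hab⟩
  have e : Set (Fin k) ≃ Fin (2 ^ k) := Fintype.equivFinOfCardEq (by simp)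
  refine h ⟨fun j => a {i | j ∈ e.symm i}, fun X => b (e X), fun j X => ?_⟩
  exact (hab (e X) {i | j ∈ e.symm i}).trans (by simp)

theorem IsNIPRel.comap {α' β' : Type*} (h : IsNIPRel R) (f : α' → α) (g : β' → β) :
    IsNIPRel fun a b => R (f a) (g b) :=
  h.imp fun _ hk => ⟨hk.1, hk.2.comap f g⟩

theorem IsNIPRel.not (h : IsNIPRel R) : IsNIPRel fun a b => ¬ R a b :=
  h.imp fun _ hk => ⟨hk.1, hk.2.not⟩

theorem IsNIPRel.flip (h : IsNIPRel R) : IsNIPRel (flip R) :=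
  let ⟨k, _, hk⟩ := h
  ⟨2 ^ k, Nat.one_le_two_pow, hk.flip⟩

open Classical in
/-- The subsets of a finite family `a` that are cut out by the sets `R · b`. -/
noncomputable def traces {I : Type*} [Fintype I] (R : α → β → Prop) (a : I → α) :
    Finset (Finset I) :=
  {s | ∃ b, ∀ i, i ∈ s ↔ R (a i) b}

theorem mem_traces {I : Type*} [Fintype I] {a : I → α} {s : Finset I} :
    s ∈ traces R a ↔ ∃ b, ∀ i, i ∈ s ↔ R (a i) b := by
  simp [traces]

open Classical in
theorem IsKNIPRel.card_lt_of_shatters {I : Type*} [Fintype I] (h : IsKNIPRel k R) {a : I → α}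
    {s : Finset I} (hs : (traces R a).Shatters s) : s.card < k := by
  by_contra! hk
  obtain ⟨t, hts, ht⟩ := Finset.exists_subset_card_eq hk
  have e : Fin k ≃ t := (t.equivFinOfCardEq ht).symm
  have key (X : Set (Fin k)) : ∃ b, ∀ i, R (a (e i)) b ↔ i ∈ X := by
    obtain ⟨u, hu, htu⟩ := (hs.mono_right hts)
      (t := t.filter fun i => ∃ j ∈ X, (e j : I) = i) (Finset.filter_subset _ _)
    obtain ⟨b, hb⟩ := mem_traces.1 hu
    refine ⟨b, fun i => ?_⟩
    have := Finset.ext_iff.1 htu (e i)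
    simpa [hb, Subtype.ext_iff.symm] using this
  choose b hb using key
  exact h ⟨fun i => a (e i), b, fun i X => hb X i⟩

theorem IsKNIPRel.card_traces_le {I : Type*} [Fintype I] (h : IsKNIPRel k R) (a : I → α) :
    (traces R a).card ≤ (Fintype.card I + 1) ^ k := by
  classical
  have hdim : (traces R a).vcDim ≤ k :=
    Finset.sup_le fun s hs => (h.card_lt_of_shatters (Finset.mem_shatterer.1 hs)).le
  calc (traces R a).card
      ≤ ∑ j ∈ Finset.Iic (traces R a).vcDim, (Fintype.card I).choose j :=
        (Finset.card_le_card_shatterer _).trans Finset.card_shatterer_le_sum_vcDim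
    _ ≤ ∑ j ∈ Finset.range (k + 1), Fintype.card I ^ j * k.choose j := by
        refine (Finset.sum_le_sum_of_subset fun j hj => ?_).trans
          (Finset.sum_le_sum fun j hj => ?_)
        · exact Finset.mem_range_succ_iff.2 ((Finset.mem_Iic.1 hj).trans hdim)
        · exact (Nat.choose_le_pow _ _).trans
            (Nat.le_mul_of_pos_right _ (Nat.choose_pos (Finset.mem_range_succ_iff.1 hj)))
    _ = (Fintype.card I + 1) ^ k := by simp [add_pow]

theorem exists_mul_pow_lt_two_pow (C a k : ℕ) : ∃ t, C * (a * t + 1) ^ k < 2 ^ t := by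
  have h := ((tendsto_pow_const_div_const_pow_of_one_lt k (one_lt_two (α := ℝ))).const_mul
    (C * (a + 1) ^ k : ℝ)).eventually_lt_const (u := 1) (by simp)
  obtain ⟨t, ht, ht1⟩ := (h.and (Filter.eventually_ge_atTop 1)).exists
  refine ⟨t, ?_⟩
  rw [← mul_div_assoc, div_lt_one (by positivity), mul_assoc, ← mul_pow] at ht
  calc C * (a * t + 1) ^ k ≤ C * ((a + 1) * t) ^ k := by gcongr; lia
    _ < 2 ^ t := mod_cast ht

theorem IsNIPRel.and (hR : IsNIPRel R) (hS : IsNIPRel S) : IsNIPRel fun a b => R a b ∧ S a b := by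
  classical
  obtain ⟨k, -, hk⟩ := hR
  obtain ⟨l, -, hl⟩ := hS
  obtain ⟨t, ht⟩ := exists_mul_pow_lt_two_pow 1 1 (k + l)
  simp only [one_mul] at ht
  have ht0 : t ≠ 0 := by rintro rfl; simp at ht
  refine ⟨t, Nat.one_le_iff_ne_zero.2 ht0, fun ⟨a, b, hab⟩ => ht.not_ge ?_⟩
  have hsub : (Finset.univ : Finset (Finset (Fin t))) ⊆
      Finset.image₂ (· ∩ ·) (traces R a) (traces S a) := fun X _ => by
    refine Finset.mem_image₂.2 ⟨({i | R (a i) (b X)} : Finset _), mem_traces.2 ⟨b X, by simp⟩,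
      ({i | S (a i) (b X)} : Finset _), mem_traces.2 ⟨b X, by simp⟩, ?_⟩
    ext i
    simpa using hab i X
  calc 2 ^ t = (Finset.univ : Finset (Finset (Fin t))).card := by simp
    _ ≤ (traces R a).card * (traces S a).card :=
        (Finset.card_le_card hsub).trans (Finset.card_image₂_le _ _ _)
    _ ≤ (t + 1) ^ k * (t + 1) ^ l := by
        gcongr
        · simpa using hk.card_traces_le a
        · simpa using hl.card_traces_le a
    _ = (t + 1) ^ (k + l) := (pow_add _ _ _).symm

theorem IsNIPRel.or (hR : IsNIPRel R) (hS : IsNIPRel S) : IsNIPRel fun a b => R a b ∨ S a b := by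
  simpa only [not_and_or, not_not] using (hR.not.and hS.not).not

end NIPRelations

section EpsilonNets

open Finset

variable {α β I : Type*} {R : α → β → Prop} {k s t : ℕ}

/-- The permutation of `Bool × I` that exchanges the two points over `i` whenever `σ i` holds. -/
def pairSwap (σ : I → Bool) : Equiv.Perm (Bool × I) :=
  Function.Involutive.toPerm (fun p => (xor p.1 (σ p.2), p.2)) fun p => by simp

theorem pairSwap_apply (σ : I → Bool) (p : Bool × I) : pairSwap σ p = (xor p.1 (σ p.2), p.2) :=
  rfl

variable [Fintype I]

theorem card_mul_card_eq_sum_card_of_bijective {Z : Type*} [Fintype Z] [DecidableEq Z]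
    {e : I → Z → Z} (he : ∀ i, Function.Bijective (e i)) (B : Finset Z) :
    Fintype.card I * #B = ∑ z, #{i | e i z ∈ B} := by
  simp_rw [card_filter]
  rw [sum_comm, ← smul_eq_mul, ← card_univ, ← sum_const]
  refine sum_congr rfl fun i _ => ?_
  rw [(he i).sum_comp fun z => if z ∈ B then 1 else 0]
  simp

theorem sum_le_mul_card_add {Z : Type*} [Fintype Z] {f : Z → ℕ} {M : ℕ} (hf : ∀ z, f z ≤ M)
    (t : ℕ) : ∑ z, f z ≤ M * #{z | t ≤ f z} + t * Fintype.card Z := by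
  have h (z : Z) : f z ≤ M * (if t ≤ f z then 1 else 0) + t := by
    have := hf z
    split_ifs <;> lia
  calc ∑ z, f z ≤ ∑ z, (M * (if t ≤ f z then 1 else 0) + t) := sum_le_sum fun z _ => h z
    _ = _ := by
        rw [sum_add_distrib, ← mul_sum, ← card_filter, sum_const, card_univ, smul_eq_mul,
          mul_comm t]

open Classical in
theorem sum_card_filter_mem [Fintype α] (X : Finset α) :
    ∑ y : I → α, #{i | y i ∈ X} =
      Fintype.card I * (Fintype.card α ^ (Fintype.card I - 1) * #X) := by
  have h (i : I) : ∑ y : I → α, (if y i ∈ X then 1 else 0) =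
      Fintype.card α ^ (Fintype.card I - 1) * #X := by
    simpa only [Fintype.piFinset_univ, card_univ, sum_ite_mem, univ_inter, sum_const, smul_eq_mul,
      mul_one] using Fintype.sum_piFinset_apply (fun a => if a ∈ X then (1 : ℕ) else 0) univ i
  simp_rw [card_filter]
  rw [sum_comm, sum_congr rfl fun i _ => h i]
  simp

open Classical in
/-- A random sample of size `2st` hits a set of density `1 / s` about `2t` times. -/
theorem card_pow_le_mul_card_hits [Fintype α] (hs : 0 < s) (ht : 0 < t)
    (hI : Fintype.card I = 2 * s * t) {X : Finset α} (hX : Fintype.card α ≤ s * #X) :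
    Fintype.card α ^ Fintype.card I ≤ 2 * s * #{y : I → α | t ≤ #{i | y i ∈ X}} := by
  set n := Fintype.card α
  set m := Fintype.card I
  set H := #{y : I → α | t ≤ #{i | y i ∈ X}}
  have hst : 0 < s * t := Nat.mul_pos hs ht
  have hmarkov : ∑ y : I → α, #{i | y i ∈ X} ≤ m * H + t * n ^ m := by
    simpa using sum_le_mul_card_add (fun y : I → α => card_le_univ {i | y i ∈ X}) t
  have hmean : m * n ^ m ≤ s * (m * H + t * n ^ m) :=
    calc m * n ^ m = m * (n ^ (m - 1) * n) := by rw [pow_sub_one_mul (by lia)]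
      _ ≤ m * (n ^ (m - 1) * (s * #X)) := by gcongr
      _ = s * ∑ y : I → α, #{i | y i ∈ X} := by rw [sum_card_filter_mem]; ring
      _ ≤ _ := by gcongr
  rw [hI] at hmean ⊢
  refine Nat.le_of_mul_le_mul_left (c := s * t) ?_ hst
  linarith

open Classical in
/-- The bad events of the double sampling argument: samples `z` whose first half misses a set
`R · b` that its second half meets at least `t` times. -/
noncomputable def badSamples [Fintype α] (I : Type*) [Fintype I] (R : α → β → Prop) (t : ℕ) :
    Finset (Bool × I → α) :=
  {z | ∃ b, (∀ i, ¬ R (z (false, i)) b) ∧ t ≤ #{i | R (z (true, i)) b}}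

open Classical in
theorem card_filter_forall_notMem_mul_le (T : Finset (Bool × I)) :
    #{σ : I → Bool | ∀ i, (σ i, i) ∉ T} * 2 ^ #(T.image Prod.snd) ≤ 2 ^ Fintype.card I := by
  have hpi : ({σ | ∀ i, (σ i, i) ∉ T} : Finset (I → Bool)) =
      Fintype.piFinset fun i => {c | (c, i) ∉ T} := by
    ext; simp
  have hpow : 2 ^ #(T.image Prod.snd) = ∏ i, if i ∈ T.image Prod.snd then 2 else 1 := by
    rw [prod_ite_mem, univ_inter, prod_const]
  rw [hpi, Fintype.card_piFinset, hpow, ← prod_mul_distrib, ← card_univ, ← prod_const]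
  refine prod_le_prod' fun i _ => ?_
  split_ifs with hi
  · obtain ⟨⟨c, _⟩, hc, rfl⟩ := mem_image.1 hi
    have : #({d | (d, _) ∉ T} : Finset Bool) < #(univ : Finset Bool) :=
      card_lt_card (filter_ssubset.2 ⟨c, mem_univ _, not_not.2 hc⟩)
    simp only [card_univ, Fintype.card_bool] at this
    lia
  · simpa using card_le_univ ({c | (c, i) ∉ T} : Finset Bool)

open Classical in
theorem IsKNIPRel.card_swaps_mul_le [Fintype α] (h : IsKNIPRel k R) (z : Bool × I → α) :
    #{σ : I → Bool | z ∘ pairSwap σ ∈ badSamples I R t} * 2 ^ t ≤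
      (2 * Fintype.card I + 1) ^ k * 2 ^ Fintype.card I := by
  -- Only the trace of `R · b` on `z` matters, so a union bound over the few traces suffices.
  set T := traces R z
  have hsub : ({σ | z ∘ pairSwap σ ∈ badSamples I R t} : Finset (I → Bool)) ⊆
      {s ∈ T | t ≤ #(s.image Prod.snd)}.biUnion fun s => {σ | ∀ i, (σ i, i) ∉ s} := by
    intro σ hσ
    simp only [badSamples, mem_filter_univ] at hσ
    obtain ⟨b, hmiss, hhit⟩ := hσ
    refine mem_biUnion.2 ⟨({p | R (z p) b} : Finset (Bool × I)),
      mem_filter.2 ⟨mem_traces.2 ⟨b, by simp⟩, ?_⟩, ?_⟩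
    · refine hhit.trans (card_le_card fun i hi => mem_image.2 ⟨(!σ i, i), ?_, rfl⟩)
      simpa only [mem_filter_univ, Function.comp_apply, pairSwap_apply, Bool.true_xor] using hi
    · simpa only [mem_filter_univ, Function.comp_apply, pairSwap_apply, Bool.false_xor] using hmiss
  calc _ ≤ (∑ s ∈ T with t ≤ #(s.image Prod.snd), #{σ : I → Bool | ∀ i, (σ i, i) ∉ s}) * 2 ^ t := by
        gcongr; exact (card_le_card hsub).trans card_biUnion_le
    _ ≤ ∑ s ∈ T with t ≤ #(s.image Prod.snd), 2 ^ Fintype.card I := by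
        rw [sum_mul]
        refine sum_le_sum fun s hs => le_trans ?_ (card_filter_forall_notMem_mul_le s)
        gcongr
        exacts [one_le_two, (mem_filter.1 hs).2]
    _ ≤ #T * 2 ^ Fintype.card I := by
        rw [sum_const, smul_eq_mul]
        gcongr
        exact filter_subset _ _
    _ ≤ _ := by
        gcongr
        simpa using h.card_traces_le z

open Classical in
theorem IsKNIPRel.card_badSamples_mul_le [Fintype α] (h : IsKNIPRel k R) :
    #(badSamples I R t) * 2 ^ t ≤
      Fintype.card α ^ (2 * Fintype.card I) * (2 * Fintype.card I + 1) ^ k := by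
  have hcount : 2 ^ Fintype.card I * #(badSamples I R t) =
      ∑ z : Bool × I → α, #{σ : I → Bool | z ∘ pairSwap σ ∈ badSamples I R t} := by
    rw [← Fintype.card_bool, ← Fintype.card_fun]
    exact card_mul_card_eq_sum_card_of_bijective
      (fun σ => ((pairSwap σ).symm.arrowCongr (Equiv.refl α)).bijective) _
  refine Nat.le_of_mul_le_mul_left (c := 2 ^ Fintype.card I) ?_ (by positivity)
  calc 2 ^ Fintype.card I * (#(badSamples I R t) * 2 ^ t)
      = ∑ z : Bool × I → α,
          #{σ : I → Bool | z ∘ pairSwap σ ∈ badSamples I R t} * 2 ^ t := by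
        rw [← sum_mul, ← mul_assoc, hcount]
    _ ≤ ∑ _z : Bool × I → α, (2 * Fintype.card I + 1) ^ k * 2 ^ Fintype.card I :=
        sum_le_sum fun z _ => h.card_swaps_mul_le z
    _ = 2 ^ Fintype.card I *
          (Fintype.card α ^ (2 * Fintype.card I) * (2 * Fintype.card I + 1) ^ k) := by
        rw [sum_const, card_univ, smul_eq_mul, Fintype.card_fun, Fintype.card_prod,
          Fintype.card_bool]
        ring

open Classical in
theorem card_pow_le_mul_card_badSamples [Fintype α] (hs : 0 < s) (ht : 0 < t)
    (hI : Fintype.card I = 2 * s * t)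
    (hR : ∀ b, Nat.card α ≤ s * Nat.card {a // R a b})
    (hmiss : ∀ x : I → α, ∃ b, ∀ i, ¬ R (x i) b) :
    Fintype.card α ^ (2 * Fintype.card I) ≤ 2 * s * #(badSamples I R t) := by
  have hsplit : #(badSamples I R t) = ∑ x : I → α, #{y : I → α |
      ∃ b, (∀ i, ¬ R (x i) b) ∧ t ≤ #{i | R (y i) b}} := by
    simp_rw [badSamples, card_filter]
    rw [← Fintype.sum_prod_type',
      ← Equiv.sum_comp ((Equiv.curry Bool I α).trans (Equiv.boolArrowEquivProd _))]
    rfl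
  have hsecond (x : I → α) : Fintype.card α ^ Fintype.card I ≤
      2 * s * #{y : I → α | ∃ b, (∀ i, ¬ R (x i) b) ∧ t ≤ #{i | R (y i) b}} := by
    obtain ⟨b, hb⟩ := hmiss x
    have hX : Fintype.card α ≤ s * #{a | R a b} := by
      simpa [Fintype.card_subtype] using hR b
    refine (card_pow_le_mul_card_hits hs ht hI hX).trans ?_
    gcongr with y
    intro hy
    exact ⟨b, hb, by simpa using hy⟩
  calc Fintype.card α ^ (2 * Fintype.card I)
      = ∑ _x : I → α, Fintype.card α ^ Fintype.card I := by simp [two_mul, pow_add]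
    _ ≤ _ := by
        rw [hsplit, mul_sum]
        exact sum_le_sum fun x _ => hsecond x

/-- The `ε`-net theorem of Haussler and Welzl for `ε = 1 / s`. That `m` depends only on `k` and `s`
is what makes the theorem pass to ultraproducts. -/
theorem exists_epsilon_net (k : ℕ) (hs : 0 < s) :
    ∃ m : ℕ, ∀ (α : Type w) (β : Type w') [Finite α] [Nonempty α] (R : α → β → Prop),
      IsKNIPRel k R → (∀ b, Nat.card α ≤ s * Nat.card {a // R a b}) →
        ∃ x : Fin m → α, ∀ b, ∃ i, R (x i) b := by
  obtain ⟨t, ht⟩ := exists_mul_pow_lt_two_pow (2 * s) (4 * s) k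
  have ht0 : 0 < t := by
    rcases t.eq_zero_or_pos with rfl | h
    · simp at ht; lia
    · exact h
  refine ⟨2 * s * t, fun α β _ _ R hR hcard => ?_⟩
  have := Fintype.ofFinite α
  by_contra! hmiss
  have hlower := card_pow_le_mul_card_badSamples hs ht0 (Fintype.card_fin _) hcard hmiss
  have hupper := hR.card_badSamples_mul_le (I := Fin (2 * s * t)) (t := t)
  rw [Fintype.card_fin] at hlower hupper
  set n := Fintype.card α ^ (2 * (2 * s * t))
  refine ht.not_ge (Nat.le_of_mul_le_mul_left (c := n) ?_ (by positivity))
  calc n * 2 ^ t ≤ 2 * s * #(badSamples (Fin (2 * s * t)) R t) * 2 ^ t := by gcongr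
    _ = 2 * s * (#(badSamples (Fin (2 * s * t)) R t) * 2 ^ t) := mul_assoc _ _ _
    _ ≤ 2 * s * (n * (2 * (2 * s * t) + 1) ^ k) := by gcongr
    _ = n * (2 * s * (4 * s * t + 1) ^ k) := by ring

end EpsilonNets

namespace ParamFormula

variable {L : FirstOrder.Language.{u, v}} {G : Type w} {α β : Type}

/-- The formula `φ(x̄; ȳ)` with the roles of `x̄` and `ȳ` exchanged. -/
def swap (φ : ParamFormula L G (α ⊕ β)) : ParamFormula L G (β ⊕ α) :=
  ⟨φ.n, φ.form.relabel (Sum.map Sum.swap id), φ.par⟩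

variable [L.Structure G]

theorem holds_swap (φ : ParamFormula L G (α ⊕ β)) (a : α → G) (b : β → G) :
    φ.swap.Holds (Sum.elim b a) ↔ φ.Holds (Sum.elim a b) := by
  rw [Holds, swap, Formula.realize_relabel, Holds]
  refine iff_of_eq (congrArg (fun t => φ.form.Realize t) ?_)
  ext ((_ | _) | _) <;> rfl

theorem IsNIP.swap {φ : ParamFormula L G (α ⊕ β)} (h : φ.IsNIP) : φ.swap.IsNIP := by
  have hrel : IsNIPRel fun (a : α → G) b => φ.Holds (Sum.elim a b) := h
  change IsNIPRel fun (b : β → G) a => φ.swap.Holds (Sum.elim b a)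
  simp only [holds_swap]
  exact hrel.flip

theorem holds_iff_mem_set (φ : ParamFormula L G (Fin 1)) (a : Fin 1 → G) :
    φ.Holds a ↔ a 0 ∈ φ.set := by
  obtain ⟨x, rfl⟩ := (Equiv.funUnique (Fin 1) G).symm.surjective a
  rfl

theorem holds_inst {k : ℕ} (δ : ParamFormula L G (α ⊕ Fin k)) (b : Fin k → G) (a : α → G) :
    (δ.inst b).Holds a ↔ δ.Holds (Sum.elim a b) := by
  rw [Holds, inst, Formula.realize_relabel, Holds]
  refine iff_of_eq (congrArg (fun t => δ.form.Realize t) ?_)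
  ext ((_ | _) | _) <;> simp

theorem set_neg (φ : ParamFormula L G (Fin 1)) : φ.neg.set = φ.setᶜ := rfl

theorem realize_relabel_castAdd (φ ψ : ParamFormula L G α) (a : α → G) :
    (φ.form.relabel (Sum.map id (Fin.castAdd ψ.n))).Realize
      (Sum.elim a (Fin.append φ.par ψ.par)) ↔ φ.Holds a := by
  rw [Formula.realize_relabel, Holds]
  refine iff_of_eq (congrArg (fun t => φ.form.Realize t) ?_)
  ext (_ | _) <;> simp

theorem realize_relabel_natAdd (φ ψ : ParamFormula L G α) (a : α → G) :
    (ψ.form.relabel (Sum.map id (Fin.natAdd φ.n))).Realize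
      (Sum.elim a (Fin.append φ.par ψ.par)) ↔ ψ.Holds a := by
  rw [Formula.realize_relabel, Holds]
  refine iff_of_eq (congrArg (fun t => ψ.form.Realize t) ?_)
  ext (_ | _) <;> simp

theorem set_conj (φ ψ : ParamFormula L G (Fin 1)) : (φ.conj ψ).set = φ.set ∩ ψ.set :=
  Set.ext fun _ => Formula.realize_inf.trans
    (and_congr (realize_relabel_castAdd φ ψ _) (realize_relabel_natAdd φ ψ _))

theorem set_disj (φ ψ : ParamFormula L G (Fin 1)) : (φ.disj ψ).set = φ.set ∪ ψ.set :=
  Set.ext fun _ => Formula.realize_sup.trans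
    (or_congr (realize_relabel_castAdd φ ψ _) (realize_relabel_natAdd φ ψ _))

variable [Group G] {mulSym : L.Functions 2}

theorem holds_left (hG : InterpretsMul mulSym G) (φ : ParamFormula L G (Fin 1)) (a b : Fin 1 → G) :
    (φ.left mulSym).Holds (Sum.elim a b) ↔ b 0 * a 0 ∈ φ.set := by
  rw [Holds, left, Formula.Realize, BoundedFormula.realize_subst]
  change _ ↔ φ.form.Realize _
  rw [Formula.Realize]
  refine iff_of_eq (congrArg (fun t => BoundedFormula.Realize φ.form t default) ?_)
  ext (c | c)
  · simpa [Term.realize_functions_apply₂] using hG _ _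
  · simp

theorem holds_right (hG : InterpretsMul mulSym G) {k : ℕ} (δ : ParamFormula L G (Fin 1 ⊕ Fin k))
    (x : G) (b : Fin (k + 1) → G) :
    (δ.right mulSym).Holds (Sum.elim (fun _ => x) b) ↔
      δ.Holds (Sum.elim (fun _ => x * b (Fin.last k)) fun j => b j.castSucc) := by
  rw [Holds, right, Formula.Realize, BoundedFormula.realize_subst, Holds, Formula.Realize]
  refine iff_of_eq (congrArg (fun t => BoundedFormula.Realize δ.form t default) ?_)
  ext ((c | c) | c)
  · simpa [Term.realize_functions_apply₂] using hG _ _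
  · simp
  · simp

end ParamFormula

section Transfer

variable {L : FirstOrder.Language.{u, v}}

/-- The assertion `[μ_θ ≤ q](z̄)` about the formula with parameters `φ(x̄) = θ(x̄; z̄)`. -/
def MeasureLE {M : Type*} [(countLang L).Structure M] {m : ℕ} (φ : ParamFormula L M (Fin m))
    (q : ℚ) : Prop :=
  RelMap (L := countLang L) (M := M) (n := φ.n) (⟨m, φ.form⟩, q) φ.par

/-- An `L`-formula as an `L⁺`-formula. -/
def liftFormula {γ : Type*} (χ : L.Formula γ) : (plusLang L).Formula γ :=
  (LHom.sumInl : L →ᴸ plusLang L).onFormula χ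

/-- The atomic `L⁺`-formula `[μ_θ ≤ q](z̄)`. -/
def countAtom {γ : Type*} {m n : ℕ} (θ : L.Formula (Fin m ⊕ Fin n)) (q : ℚ) (s : Fin n → γ) :
    (plusLang L).Formula γ :=
  Relations.formula (L := plusLang L) (n := n) (Sum.inr (⟨m, θ⟩, q)) fun j => Term.var (s j)

theorem realize_liftFormula {M : Type*} [L.Structure M] [(countLang L).Structure M] {γ : Type*}
    (χ : L.Formula γ) (z : γ → M) : (liftFormula χ).Realize z ↔ χ.Realize z :=
  LHom.realize_onFormula _ _

theorem realize_countAtom {M : Type*} [L.Structure M] [(countLang L).Structure M] {γ : Type*}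
    {m n : ℕ} (θ : L.Formula (Fin m ⊕ Fin n)) (q : ℚ) (s : Fin n → γ) (z : γ → M) :
    (countAtom θ q s).Realize z ↔ MeasureLE (⟨n, θ, z ∘ s⟩ : ParamFormula L M (Fin m)) q :=
  Formula.realize_rel

theorem measureLE_countStructure {A : Type w} [L.Structure A] {m : ℕ}
    (φ : ParamFormula L A (Fin m)) (q : ℚ) :
    letI := countStructure L A
    MeasureLE φ q ↔ (Nat.card {a // φ.Holds a} : ℚ) / Nat.card (Fin m → A) ≤ q :=
  Iff.rfl

theorem sumStructure_ultraproduct {L' : FirstOrder.Language} {ι : Type w} (U : Ultrafilter ι)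
    (A : ι → Type w') [∀ i, L.Structure (A i)] [∀ i, L'.Structure (A i)] :
    sumStructure L L' ((U : Filter ι).Product A) =
      Ultraproduct.structure (L := L.sum L') (M := A) (u := U) := by
  ext n f x
  · cases f <;> rfl
  · cases f <;> rfl

theorem realize_of_forall_realize_countStructure {ι : Type w} {U : Ultrafilter ι}
    {A : ι → Type w'} [∀ i, L.Structure (A i)] [∀ i, Nonempty (A i)] {G : Type w''} [L.Structure G]
    [(countLang L).Structure G] (hext : IsElementaryExtensionOfUltraproduct L U A G)
    {γ : Type*} [Finite γ] (ψ : (plusLang L).Formula γ)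
    (h : letI : ∀ i, (countLang L).Structure (A i) := fun i => countStructure L (A i)
      ∀ i (z : γ → A i), ψ.Realize z) (z : γ → G) : ψ.Realize z := by
  let : ∀ i, (countLang L).Structure (A i) := fun i => countStructure L (A i)
  obtain ⟨f⟩ := hext
  let σ : (plusLang L).Sentence := Formula.iAlls γ (ψ.relabel (Sum.inr : γ → Empty ⊕ γ))
  have hU : (U : Filter ι).Product A ⊨ σ := by
    convert (Ultraproduct.sentence_realize (u := U) (M := A) (L := plusLang L) σ).2
      (Filter.Eventually.of_forall fun i => ?_) using 1
    · exact sumStructure_ultraproduct U A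
    · simp only [σ, Sentence.Realize, Formula.realize_iAlls, Formula.realize_relabel]
      exact h i
  have hσG : G ⊨ σ := (f.map_sentence σ).1 hU
  simp only [σ, Sentence.Realize, Formula.realize_iAlls, Formula.realize_relabel] at hσG
  exact hσG z

end Transfer

section Measure

variable {L : FirstOrder.Language.{u, v}}

/-- The `L`-formula saying that `θ(x̄; z̄)` implies `⋁ᵢ ηᵢ(x̄; z̄ᵢ)`. -/
noncomputable def coverFormula {κ : Type*} [Finite κ] {m n : ℕ} {l : κ → ℕ}
    (θ : L.Formula (Fin m ⊕ Fin n)) (η : ∀ i, L.Formula (Fin m ⊕ Fin (l i))) :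
    L.Formula (Fin n ⊕ Σ i, Fin (l i)) :=
  Formula.iAlls (Fin m) ((θ.relabel (Sum.elim Sum.inr fun j => Sum.inl (Sum.inl j))).imp
    (Formula.iSup fun i => (η i).relabel (Sum.elim Sum.inr fun j => Sum.inl (Sum.inr ⟨i, j⟩))))

theorem realize_coverFormula {M : Type*} [L.Structure M] {κ : Type*} [Finite κ] {m n : ℕ}
    {l : κ → ℕ} (θ : L.Formula (Fin m ⊕ Fin n)) (η : ∀ i, L.Formula (Fin m ⊕ Fin (l i)))
    (z : (Fin n ⊕ Σ i, Fin (l i)) → M) :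
    (coverFormula θ η).Realize z ↔ ∀ a,
      (⟨n, θ, z ∘ Sum.inl⟩ : ParamFormula L M (Fin m)).Holds a →
        ∃ i, (⟨l i, η i, fun j => z (Sum.inr ⟨i, j⟩)⟩ : ParamFormula L M (Fin m)).Holds a := by
  simp only [coverFormula, Formula.realize_iAlls, Formula.realize_imp, Formula.realize_iSup,
    Formula.realize_relabel, ParamFormula.Holds, Function.comp_def]
  congr! <;> rename_i c <;> cases c <;> rfl

theorem card_holds_le_sum {M κ : Type*} [Finite M] [L.Structure M] [Fintype κ] {m : ℕ}
    {φ : ParamFormula L M (Fin m)} {ψ : κ → ParamFormula L M (Fin m)}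
    (h : ∀ a, φ.Holds a → ∃ i, (ψ i).Holds a) :
    Nat.card {a // φ.Holds a} ≤ ∑ i, Nat.card {a // (ψ i).Holds a} := by
  choose i hi using h
  rw [← Nat.card_sigma]
  refine Nat.card_le_card_of_injective
    (fun a : {a // φ.Holds a} => (⟨i a a.2, a, hi a a.2⟩ : Σ i, {a // (ψ i).Holds a}))
    fun a b hab => Subtype.ext ?_
  simpa using congrArg (fun c => (c.2 : Fin m → M)) hab

variable {ι : Type w} {U : Ultrafilter ι} {A : ι → Type w'} [∀ i, L.Structure (A i)]
  [∀ i, Nonempty (A i)] {G : Type w''} [L.Structure G] [(countLang L).Structure G]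
  {m : ℕ} {φ : ParamFormula L G (Fin m)}

theorem MeasureLE.nonneg (hext : IsElementaryExtensionOfUltraproduct L U A G) {q : ℚ}
    (h : MeasureLE φ q) : 0 ≤ q := by
  let : ∀ i, (countLang L).Structure (A i) := fun i => countStructure L (A i)
  by_contra! hq
  have key := realize_of_forall_realize_countStructure hext (countAtom φ.form q id).not
    (fun i z => by
      rw [Formula.realize_not, realize_countAtom, measureLE_countStructure, not_le]
      exact hq.trans_le (by positivity)) φ.par
  rw [Formula.realize_not, realize_countAtom] at key
  exact key h

theorem one_le_of_measureLE_top (hext : IsElementaryExtensionOfUltraproduct L U A G)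
    [∀ i, Finite (A i)] {q : ℚ} (h : MeasureLE (⟨0, ⊤, default⟩ : ParamFormula L G (Fin m)) q) :
    1 ≤ q := by
  let : ∀ i, (countLang L).Structure (A i) := fun i => countStructure L (A i)
  by_contra! hq
  have key := realize_of_forall_realize_countStructure hext
    (countAtom (m := m) (n := 0) (⊤ : L.Formula _) q id).not
    (fun i z => by
      rw [Formula.realize_not, realize_countAtom, measureLE_countStructure, not_le]
      have hall : ∀ a, (⟨0, ⊤, z ∘ id⟩ : ParamFormula L (A i) (Fin m)).Holds a :=
        fun _ => Formula.realize_top.2 trivial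
      rwa [Nat.card_congr (Equiv.subtypeUnivEquiv hall),
        div_self (Nat.cast_ne_zero.2 Nat.card_pos.ne')])
    default
  rw [Formula.realize_not, realize_countAtom] at key
  exact key h

theorem measureLE_one (hext : IsElementaryExtensionOfUltraproduct L U A G)
    [∀ i, Finite (A i)] (φ : ParamFormula L G (Fin m)) : MeasureLE φ 1 := by
  let : ∀ i, (countLang L).Structure (A i) := fun i => countStructure L (A i)
  refine (realize_countAtom φ.form 1 id φ.par).1
    (realize_of_forall_realize_countStructure hext _ (fun i z => ?_) φ.par)
  rw [realize_countAtom, measureLE_countStructure]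
  exact div_le_one_of_le₀ (mod_cast Finite.card_subtype_le _) (by positivity)

theorem MeasureLE.of_cover (hext : IsElementaryExtensionOfUltraproduct L U A G)
    [∀ i, Finite (A i)] {κ : Type*} [Fintype κ] {ψ : κ → ParamFormula L G (Fin m)} {q : κ → ℚ}
    (h : ∀ a, φ.Holds a → ∃ i, (ψ i).Holds a) (hq : ∀ i, MeasureLE (ψ i) (q i)) :
    MeasureLE φ (∑ i, q i) := by
  let : ∀ i, (countLang L).Structure (A i) := fun i => countStructure L (A i)
  have key := realize_of_forall_realize_countStructure hext
    ((liftFormula (coverFormula φ.form fun i => (ψ i).form) ⊓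
      Formula.iInf fun i => countAtom (ψ i).form (q i) fun j => Sum.inr ⟨i, j⟩).imp
        (countAtom φ.form (∑ i, q i) Sum.inl))
    (fun i z => by
      simp only [Formula.realize_imp, Formula.realize_inf, Formula.realize_iInf,
        realize_liftFormula, realize_coverFormula, realize_countAtom, measureLE_countStructure]
      rintro ⟨hcover, hle⟩
      refine le_trans ?_ (Finset.sum_le_sum fun i _ => hle i)
      rw [← Finset.sum_div]
      gcongr
      exact_mod_cast card_holds_le_sum hcover)
    (Sum.elim φ.par fun p => (ψ p.1).par p.2)
  simp only [Formula.realize_imp, Formula.realize_inf, Formula.realize_iInf, realize_liftFormula,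
    realize_coverFormula, realize_countAtom] at key
  exact key ⟨h, hq⟩

theorem mu_le_of_measureLE (hext : IsElementaryExtensionOfUltraproduct L U A G) {q : ℚ}
    (h : MeasureLE φ q) : mu φ ≤ q :=
  csInf_le ⟨0, by rintro _ ⟨r, rfl, hr⟩; exact_mod_cast MeasureLE.nonneg hext hr⟩ ⟨q, rfl, h⟩

theorem exists_measureLE_lt (hext : IsElementaryExtensionOfUltraproduct L U A G)
    [∀ i, Finite (A i)] {r : ℝ} (h : mu φ < r) : ∃ q : ℚ, MeasureLE φ q ∧ (q : ℝ) < r := by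
  obtain ⟨_, ⟨q, rfl, hq⟩, hr⟩ := exists_lt_of_csInf_lt
    (s := {r : ℝ | ∃ q : ℚ, r = q ∧ MeasureLE φ q}) ⟨_, 1, rfl, measureLE_one hext φ⟩ h
  exact ⟨q, hq, hr⟩

theorem mu_le_sum_mu (hext : IsElementaryExtensionOfUltraproduct L U A G)
    [∀ i, Finite (A i)] {κ : Type*} [Fintype κ] {ψ : κ → ParamFormula L G (Fin m)}
    (h : ∀ a, φ.Holds a → ∃ i, (ψ i).Holds a) : mu φ ≤ ∑ i, mu (ψ i) := by
  refine le_of_forall_pos_le_add fun ε hε => ?_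
  have hsmall : Fintype.card κ * (ε / (Fintype.card κ + 1)) ≤ ε := by
    rw [mul_div_left_comm]
    exact mul_le_of_le_one_right hε.le (div_le_one_of_le₀ (by simp) (by positivity))
  choose q hq hlt using fun i => exists_measureLE_lt (φ := ψ i) hext
    (lt_add_of_pos_right _ (show 0 < ε / (Fintype.card κ + 1) by positivity))
  calc mu φ ≤ ((∑ i, q i : ℚ) : ℝ) := mu_le_of_measureLE hext (.of_cover hext h hq)
    _ = ∑ i, (q i : ℝ) := by push_cast; rfl
    _ ≤ ∑ i, (mu (ψ i) + ε / (Fintype.card κ + 1)) := Finset.sum_le_sum fun i _ => (hlt i).le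
    _ = ∑ i, mu (ψ i) + Fintype.card κ * (ε / (Fintype.card κ + 1)) := by
        rw [Finset.sum_add_distrib, Finset.sum_const, Finset.card_univ, nsmul_eq_mul]
    _ ≤ ∑ i, mu (ψ i) + ε := by gcongr

theorem one_le_sum_mu (hext : IsElementaryExtensionOfUltraproduct L U A G)
    [∀ i, Finite (A i)] {κ : Type*} [Fintype κ] {ψ : κ → ParamFormula L G (Fin m)}
    (h : ∀ a, ∃ i, (ψ i).Holds a) : 1 ≤ ∑ i, mu (ψ i) := by
  refine le_trans ?_ (mu_le_sum_mu (φ := ⟨0, ⊤, default⟩) hext fun a _ => h a)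
  refine le_csInf ⟨_, 1, rfl, measureLE_one hext _⟩ ?_
  rintro _ ⟨q, rfl, hq⟩
  exact_mod_cast one_le_of_measureLE_top hext hq

end Measure

section Nets

variable {L : FirstOrder.Language.{u, v}} {k l m n : ℕ}

/-- The atomic `L⁺`-formula `[μ_χ(x̄; ȳ) ≤ q](ȳ, z̄)` in which `ȳ` has been moved from the object
variables of `χ(x̄, ȳ; z̄)` to its parameter variables, as in `ParamFormula.inst`. -/
def instCountAtom (χ : L.Formula ((Fin m ⊕ Fin l) ⊕ Fin n)) (q : ℚ) :
    (plusLang L).Formula (Fin n ⊕ Fin l) :=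
  countAtom (χ.relabel (Sum.elim (Sum.map id (Fin.castAdd n)) fun j => Sum.inr (Fin.natAdd l j))) q
    (Fin.append Sum.inr Sum.inl)

theorem realize_instCountAtom {M : Type*} [L.Structure M] [(countLang L).Structure M]
    (χ : L.Formula ((Fin m ⊕ Fin l) ⊕ Fin n)) (q : ℚ) (z : Fin n ⊕ Fin l → M) :
    (instCountAtom χ q).Realize z ↔ MeasureLE
      ((⟨n, χ, z ∘ Sum.inl⟩ : ParamFormula L M (Fin m ⊕ Fin l)).inst (z ∘ Sum.inr)) q := by
  have hz : z ∘ Fin.append Sum.inr Sum.inl = Fin.append (z ∘ Sum.inr) (z ∘ Sum.inl) := by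
    ext j
    cases j using Fin.addCases <;> simp
  rw [instCountAtom, realize_countAtom, hz]
  rfl

/-- The `L`-formula in the variables `z̄` saying that `χ(x̄, ȳ; z̄)` shatters `k` tuples. -/
noncomputable def shatterFormula (k : ℕ) (χ : L.Formula ((Fin m ⊕ Fin l) ⊕ Fin n)) :
    L.Formula (Fin n) :=
  Formula.iExs ((Fin k × Fin m) ⊕ (Set (Fin k) × Fin l))
    (Formula.iInf fun p : Fin k × Set (Fin k) =>
      open Classical in
      let χp := χ.relabel (Sum.elim (Sum.elim (fun j => Sum.inr (Sum.inl (p.1, j)))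
        fun j => Sum.inr (Sum.inr (p.2, j))) Sum.inl)
      if p.1 ∈ p.2 then χp else χp.not)

theorem realize_shatterFormula {M : Type*} [L.Structure M]
    (χ : L.Formula ((Fin m ⊕ Fin l) ⊕ Fin n)) (z : Fin n → M) :
    (shatterFormula k χ).Realize z ↔
      ¬ (⟨n, χ, z⟩ : ParamFormula L M (Fin m ⊕ Fin l)).IsKNIP k := by
  rw [ParamFormula.IsKNIP, not_not, shatterFormula, Formula.realize_iExs, ← Prod.exists']
  let e : ((Fin k × Fin m) ⊕ (Set (Fin k) × Fin l) → M) ≃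
      (Fin k → Fin m → M) × (Set (Fin k) → Fin l → M) :=
    (Equiv.sumArrowEquivProdArrow _ _ M).trans ((Equiv.curry _ _ M).prodCongr (Equiv.curry _ _ M))
  refine e.exists_congr fun v => ?_
  rw [Formula.realize_iInf, Prod.forall]
  refine forall₂_congr fun i X => ?_
  have hχ : (χ.relabel (Sum.elim (Sum.elim (fun j => Sum.inr (Sum.inl (i, j)))
      fun j => Sum.inr (Sum.inr (X, j))) Sum.inl)).Realize (Sum.elim z v) ↔
        (⟨n, χ, z⟩ : ParamFormula L M _).Holds (Sum.elim ((e v).1 i) ((e v).2 X)) := by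
    rw [Formula.realize_relabel, ParamFormula.Holds]
    refine iff_of_eq (congrArg (fun t => χ.Realize t) ?_)
    ext ((_ | _) | _) <;> rfl
  by_cases hi : i ∈ X <;>
    simp only [hi, if_true, if_false, Formula.realize_not, hχ, iff_true, iff_false]

/-- The `L`-formula in the variables `z̄` saying that there are `N` tuples `x̄` such that every `ȳ`
satisfies `χ(x̄, ȳ; z̄)` for one of them. -/
noncomputable def netFormula (N : ℕ) (χ : L.Formula ((Fin m ⊕ Fin l) ⊕ Fin n)) :
    L.Formula (Fin n) :=
  Formula.iExs (Fin N × Fin m) (Formula.iAlls (Fin l) (Formula.iSup fun i : Fin N =>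
    χ.relabel (Sum.elim (Sum.elim (fun j => Sum.inl (Sum.inr (i, j))) Sum.inr)
      fun j => Sum.inl (Sum.inl j))))

theorem realize_netFormula {M : Type*} [L.Structure M] (N : ℕ)
    (χ : L.Formula ((Fin m ⊕ Fin l) ⊕ Fin n)) (z : Fin n → M) :
    (netFormula N χ).Realize z ↔ ∃ a : Fin N → Fin m → M, ∀ b, ∃ i,
      (⟨n, χ, z⟩ : ParamFormula L M (Fin m ⊕ Fin l)).Holds (Sum.elim (a i) b) := by
  simp only [netFormula, Formula.realize_iExs, Formula.realize_iAlls, Formula.realize_iSup,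
    Formula.realize_relabel, ParamFormula.Holds]
  refine (Equiv.curry (Fin N) (Fin m) M).exists_congr fun a => forall_congr' fun b =>
    exists_congr fun i => iff_of_eq (congrArg (fun t => χ.Realize t) ?_)
  ext ((_ | _) | _) <;> rfl

variable {ι : Type w} {U : Ultrafilter ι} {A : ι → Type w'} [∀ i, L.Structure (A i)]
  [∀ i, Nonempty (A i)] {G : Type w''} [L.Structure G] [(countLang L).Structure G]

theorem mu_inst_eq_of_card_eq (hext : IsElementaryExtensionOfUltraproduct L U A G)
    {χ : L.Formula ((Fin m ⊕ Fin l) ⊕ Fin n)} {θ : L.Formula (Fin m ⊕ Fin n)}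
    (hcard : ∀ i (b : Fin l → A i) (z : Fin n → A i),
      Nat.card {a // (⟨n, χ, z⟩ : ParamFormula L (A i) (Fin m ⊕ Fin l)).Holds (Sum.elim a b)} =
        Nat.card {a // (⟨n, θ, z⟩ : ParamFormula L (A i) (Fin m)).Holds a})
    (par : Fin n → G) (b : Fin l → G) :
    mu ((⟨n, χ, par⟩ : ParamFormula L G (Fin m ⊕ Fin l)).inst b) =
      mu (⟨n, θ, par⟩ : ParamFormula L G (Fin m)) := by
  let : ∀ i, (countLang L).Structure (A i) := fun i => countStructure L (A i)
  have key (q : ℚ) := realize_of_forall_realize_countStructure hext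
    ((instCountAtom χ q).iff (countAtom θ q Sum.inl))
    (fun i z => by
      simp only [Formula.realize_iff, realize_instCountAtom, realize_countAtom,
        measureLE_countStructure, ParamFormula.holds_inst, hcard])
    (Sum.elim par b)
  simp only [Formula.realize_iff, realize_instCountAtom, realize_countAtom] at key
  exact congrArg sInf (Set.ext fun r => exists_congr fun q => and_congr_right fun _ => key q)

theorem exists_net_of_forall_not_measureLE (hext : IsElementaryExtensionOfUltraproduct L U A G)
    [∀ i, Finite (A i)] {ρ : ParamFormula L G (Fin m ⊕ Fin l)} (hρ : ρ.IsKNIP k) {s : ℕ}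
    (hs : 0 < s) (h : ∀ b, ¬ MeasureLE (ρ.inst b) (1 / s)) :
    ∃ (N : ℕ) (a : Fin N → Fin m → G), ∀ b, ∃ i, ρ.Holds (Sum.elim (a i) b) := by
  let : ∀ i, (countLang L).Structure (A i) := fun i => countStructure L (A i)
  obtain ⟨N, hN⟩ := exists_epsilon_net.{w', w'} k hs
  refine ⟨N, ?_⟩
  have key := realize_of_forall_realize_countStructure hext
    (((liftFormula (shatterFormula k ρ.form)).not ⊓
      Formula.iAlls (Fin l) (instCountAtom ρ.form (1 / s)).not).imp
        (liftFormula (netFormula N ρ.form)))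
    (fun i z => by
      simp only [Formula.realize_imp, Formula.realize_inf, Formula.realize_not,
        Formula.realize_iAlls, realize_liftFormula, realize_shatterFormula, realize_netFormula,
        realize_instCountAtom, measureLE_countStructure, ParamFormula.holds_inst, not_not, not_le]
      rintro ⟨hnip, hlarge⟩
      refine hN _ _ (fun a b => ParamFormula.Holds ⟨ρ.n, ρ.form, z⟩ (Sum.elim a b)) hnip fun b => ?_
      have := hlarge b
      rw [div_lt_div_iff₀ (by positivity) (mod_cast Nat.card_pos), one_mul, mul_comm] at this
      exact_mod_cast this.le)
    ρ.par
  simp only [Formula.realize_imp, Formula.realize_inf, Formula.realize_not, Formula.realize_iAlls,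
    realize_liftFormula, realize_shatterFormula, realize_netFormula, realize_instCountAtom,
    not_not] at key
  exact key ⟨hρ, h⟩

theorem ParamFormula.IsNIP.exists_net (hext : IsElementaryExtensionOfUltraproduct L U A G)
    [∀ i, Finite (A i)] {ρ : ParamFormula L G (Fin m ⊕ Fin l)} (hρ : ρ.IsNIP) {ε : ℝ} (hε : 0 < ε)
    (h : ∀ b, ε ≤ mu (ρ.inst b)) :
    ∃ (N : ℕ) (a : Fin N → Fin m → G), ∀ b, ∃ i, ρ.Holds (Sum.elim (a i) b) := by
  obtain ⟨k, -, hk⟩ := hρ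
  obtain ⟨s, hs⟩ := exists_nat_one_div_lt hε
  refine exists_net_of_forall_not_measureLE hext hk s.succ_pos fun b hb => hs.not_ge ?_
  simpa using (h b).trans (mu_le_of_measureLE hext hb)

end Nets

section GenericSets

variable {G : Type*} [Group G] {X : Set G}

theorem isLeftGeneric_iff :
    IsLeftGeneric X ↔ ∃ (N : ℕ) (g : Fin N → G), ∀ x, ∃ i, g i * x ∈ X := by
  constructor
  · rintro ⟨N, -, g, hg⟩
    refine ⟨N, fun i => (g i)⁻¹, fun x => ?_⟩
    obtain ⟨i, y, hy, rfl⟩ := Set.mem_iUnion.1 (hg ▸ Set.mem_univ x)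
    exact ⟨i, by simpa using hy⟩
  · rintro ⟨N, g, hg⟩
    refine ⟨N, (hg 1).choose.pos, fun i => (g i)⁻¹, Set.eq_univ_of_forall fun x => ?_⟩
    obtain ⟨i, hi⟩ := hg x
    exact Set.mem_iUnion.2 ⟨i, g i * x, hi, by simp⟩

theorem isRightGeneric_iff :
    IsRightGeneric X ↔ ∃ (N : ℕ) (g : Fin N → G), ∀ x, ∃ i, x * g i ∈ X := by
  constructor
  · rintro ⟨N, -, g, hg⟩
    refine ⟨N, fun i => (g i)⁻¹, fun x => ?_⟩
    obtain ⟨i, y, hy, rfl⟩ := Set.mem_iUnion.1 (hg ▸ Set.mem_univ x)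
    exact ⟨i, by simpa using hy⟩
  · rintro ⟨N, g, hg⟩
    refine ⟨N, (hg 1).choose.pos, fun i => (g i)⁻¹, Set.eq_univ_of_forall fun x => ?_⟩
    obtain ⟨i, hi⟩ := hg x
    exact Set.mem_iUnion.2 ⟨i, x * g i, hi, by simp⟩

theorem IsLeftGeneric.preimage_mul_left (h : IsLeftGeneric X) (g : G) :
    IsLeftGeneric ((g * ·) ⁻¹' X) := by
  obtain ⟨N, a, ha⟩ := isLeftGeneric_iff.1 h
  exact isLeftGeneric_iff.2 ⟨N, fun i => g⁻¹ * a i, fun x => by simpa [← mul_assoc] using ha x⟩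

theorem IsLeftGeneric.preimage_mul_right (h : IsLeftGeneric X) (g : G) :
    IsLeftGeneric ((· * g) ⁻¹' X) := by
  obtain ⟨N, a, ha⟩ := isLeftGeneric_iff.1 h
  exact isLeftGeneric_iff.2 ⟨N, a, fun x => by simpa [mul_assoc] using ha (x * g)⟩

end GenericSets

section Genericity

variable {L : FirstOrder.Language.{u, v}} {mulSym : L.Functions 2}
  {ι : Type w} {U : Ultrafilter ι} {A : ι → Type w'} [∀ i, Group (A i)] [∀ i, L.Structure (A i)]
  {G : Type w''} [L.Structure G] [(countLang L).Structure G]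
  {φ : ParamFormula L G (Fin 1)}

theorem mu_inst_left (hA : ∀ i, InterpretsMul mulSym (A i))
    (hext : IsElementaryExtensionOfUltraproduct L U A G) (φ : ParamFormula L G (Fin 1))
    (b : Fin 1 → G) : mu ((φ.left mulSym).inst b) = mu φ := by
  refine mu_inst_eq_of_card_eq hext (fun i b z => Nat.card_congr
    ((Equiv.mulLeft b).subtypeEquiv fun a => ?_)) φ.par b
  rw [ParamFormula.holds_iff_mem_set]
  exact ParamFormula.holds_left (hA i) ⟨φ.n, φ.form, z⟩ a b

theorem mu_inst_swap_left (hA : ∀ i, InterpretsMul mulSym (A i))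
    (hext : IsElementaryExtensionOfUltraproduct L U A G) (φ : ParamFormula L G (Fin 1))
    (b : Fin 1 → G) : mu ((φ.left mulSym).swap.inst b) = mu φ := by
  refine mu_inst_eq_of_card_eq hext (fun i b z => Nat.card_congr
    ((Equiv.mulRight b).subtypeEquiv fun a => ?_)) φ.par b
  rw [ParamFormula.holds_iff_mem_set]
  exact (ParamFormula.holds_swap (ParamFormula.left mulSym ⟨φ.n, φ.form, z⟩) b a).trans
    (ParamFormula.holds_left (hA i) _ _ _)

variable [Group G] [∀ i, Finite (A i)]

theorem mu_pos_of_isLeftGeneric (hA : ∀ i, InterpretsMul mulSym (A i))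
    (hG : InterpretsMul mulSym G) (hext : IsElementaryExtensionOfUltraproduct L U A G)
    (h : IsLeftGeneric φ.set) : 0 < mu φ := by
  obtain ⟨N, g, hg⟩ := isLeftGeneric_iff.1 h
  have hcover : 1 ≤ ∑ i, mu ((φ.left mulSym).inst fun _ => g i) :=
    one_le_sum_mu hext fun a => (hg (a 0)).imp fun i hi => by
      rwa [ParamFormula.holds_inst, ParamFormula.holds_left hG]
  simp only [mu_inst_left hA hext, Finset.sum_const, nsmul_eq_mul] at hcover
  exact pos_of_mul_pos_right (one_pos.trans_le hcover) (Nat.cast_nonneg _)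

theorem mu_pos_of_isRightGeneric (hA : ∀ i, InterpretsMul mulSym (A i))
    (hG : InterpretsMul mulSym G) (hext : IsElementaryExtensionOfUltraproduct L U A G)
    (h : IsRightGeneric φ.set) : 0 < mu φ := by
  obtain ⟨N, g, hg⟩ := isRightGeneric_iff.1 h
  have hcover : 1 ≤ ∑ i, mu ((φ.left mulSym).swap.inst fun _ => g i) :=
    one_le_sum_mu hext fun a => (hg (a 0)).imp fun i hi => by
      rwa [ParamFormula.holds_inst, ParamFormula.holds_swap, ParamFormula.holds_left hG]
  simp only [mu_inst_swap_left hA hext, Finset.sum_const, nsmul_eq_mul] at hcover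
  exact pos_of_mul_pos_right (one_pos.trans_le hcover) (Nat.cast_nonneg _)

theorem isRightGeneric_of_mu_pos (hA : ∀ i, InterpretsMul mulSym (A i))
    (hG : InterpretsMul mulSym G) (hext : IsElementaryExtensionOfUltraproduct L U A G)
    (hφ : (φ.left mulSym).IsNIP) (hpos : 0 < mu φ) : IsRightGeneric φ.set := by
  obtain ⟨N, a, ha⟩ := hφ.exists_net hext hpos fun b => (mu_inst_left hA hext φ b).ge
  exact isRightGeneric_iff.2 ⟨N, fun i => a i 0, fun x => (ha fun _ => x).imp fun i =>
    (ParamFormula.holds_left hG _ _ _).1⟩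

theorem isLeftGeneric_of_mu_pos (hA : ∀ i, InterpretsMul mulSym (A i))
    (hG : InterpretsMul mulSym G) (hext : IsElementaryExtensionOfUltraproduct L U A G)
    (hφ : (φ.left mulSym).IsNIP) (hpos : 0 < mu φ) : IsLeftGeneric φ.set := by
  obtain ⟨N, a, ha⟩ := hφ.swap.exists_net hext hpos fun b => (mu_inst_swap_left hA hext φ b).ge
  exact isLeftGeneric_iff.2 ⟨N, fun i => a i 0, fun x => (ha fun _ => x).imp fun i hi =>
    (ParamFormula.holds_left hG _ _ _).1 ((ParamFormula.holds_swap _ _ _).1 hi)⟩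

theorem isLeftGeneric_iff_mu_pos (hA : ∀ i, InterpretsMul mulSym (A i))
    (hG : InterpretsMul mulSym G) (hext : IsElementaryExtensionOfUltraproduct L U A G)
    (hφ : (φ.left mulSym).IsNIP) : IsLeftGeneric φ.set ↔ 0 < mu φ :=
  ⟨mu_pos_of_isLeftGeneric hA hG hext, isLeftGeneric_of_mu_pos hA hG hext hφ⟩

theorem isRightGeneric_iff_mu_pos (hA : ∀ i, InterpretsMul mulSym (A i))
    (hG : InterpretsMul mulSym G) (hext : IsElementaryExtensionOfUltraproduct L U A G)
    (hφ : (φ.left mulSym).IsNIP) : IsRightGeneric φ.set ↔ 0 < mu φ :=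
  ⟨mu_pos_of_isRightGeneric hA hG hext, isRightGeneric_of_mu_pos hA hG hext hφ⟩

theorem isLeftGeneric_iff_isRightGeneric (hA : ∀ i, InterpretsMul mulSym (A i))
    (hG : InterpretsMul mulSym G) (hext : IsElementaryExtensionOfUltraproduct L U A G)
    (hφ : (φ.left mulSym).IsNIP) : IsLeftGeneric φ.set ↔ IsRightGeneric φ.set :=
  (isLeftGeneric_iff_mu_pos hA hG hext hφ).trans (isRightGeneric_iff_mu_pos hA hG hext hφ).symm

end Genericity

namespace ParamFormula

variable {L : FirstOrder.Language.{u, v}} {G : Type w} [L.Structure G] {k : ℕ}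
  {δ : ParamFormula L G (Fin 1 ⊕ Fin k)} {φ : ParamFormula L G (Fin 1)}

/-- The instances `δ(x; b̄)` are closed under the substitution `x ↦ f x`, up to equivalence in `G`.
For `f` ranging over the left translations this is `ParamFormula.IsLeftInvariant`. -/
def IsStableUnder (δ : ParamFormula L G (Fin 1 ⊕ Fin k)) (f : G → G) : Prop :=
  ∀ b, ∃ c, (δ.inst c).set = f ⁻¹' (δ.inst b).set

theorem mem_set_inst (δ : ParamFormula L G (Fin 1 ⊕ Fin k)) (b : Fin k → G) (x : G) :
    x ∈ (δ.inst b).set ↔ δ.Holds (Sum.elim (fun _ => x) b) :=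
  holds_inst δ b _

theorem IsDeltaFormula.exists_set_eq_preimage (hφ : δ.IsDeltaFormula φ) {f : G → G}
    (hf : δ.IsStableUnder f) : ∃ ψ, δ.IsDeltaFormula ψ ∧ ψ.set = f ⁻¹' φ.set := by
  induction hφ with
  | inst b =>
    obtain ⟨c, hc⟩ := hf b
    exact ⟨_, .inst c, hc⟩
  | neg _ ih =>
    obtain ⟨ψ, hψ, h⟩ := ih
    exact ⟨_, hψ.neg, by rw [set_neg, h, set_neg, Set.preimage_compl]⟩
  | conj _ _ ih₁ ih₂ =>
    obtain ⟨ψ₁, hψ₁, h₁⟩ := ih₁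
    obtain ⟨ψ₂, hψ₂, h₂⟩ := ih₂
    exact ⟨_, hψ₁.conj hψ₂, by rw [set_conj, h₁, h₂, set_conj, Set.preimage_inter]⟩
  | disj _ _ ih₁ ih₂ =>
    obtain ⟨ψ₁, hψ₁, h₁⟩ := ih₁
    obtain ⟨ψ₂, hψ₂, h₂⟩ := ih₂
    exact ⟨_, hψ₁.disj hψ₂, by rw [set_disj, h₁, h₂, set_disj, Set.preimage_union]⟩

variable [Group G] {mulSym : L.Functions 2}

theorem IsLeftInvariant.isStableUnder (h : δ.IsLeftInvariant) (g : G) :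
    δ.IsStableUnder (g * ·) := fun b =>
  (h g b).imp fun c hc => Set.ext fun x => by simp only [Set.mem_preimage, mem_set_inst, hc]

theorem isNIP_left_iff (hG : InterpretsMul mulSym G) (φ : ParamFormula L G (Fin 1)) :
    (φ.left mulSym).IsNIP ↔ IsNIPRel fun x y : G => y * x ∈ φ.set := by
  change IsNIPRel (fun a b : Fin 1 → G => (φ.left mulSym).Holds (Sum.elim a b)) ↔ _
  simp only [holds_left hG]
  exact ⟨fun h => h.comap (fun x _ => x) fun y _ => y,
    fun h => h.comap (fun a : Fin 1 → G => a 0) fun b : Fin 1 → G => b 0⟩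

theorem IsLeftInvariant.isNIP_left_inst (hG : InterpretsMul mulSym G) (hinv : δ.IsLeftInvariant)
    (hδ : δ.IsNIP) (b : Fin k → G) : ((δ.inst b).left mulSym).IsNIP := by
  have hrel : IsNIPRel fun (a : Fin 1 → G) (c : Fin k → G) => δ.Holds (Sum.elim a c) := hδ
  choose c hc using hinv
  simp only [isNIP_left_iff hG, mem_set_inst, hc]
  exact hrel.comap (fun x _ => x) fun y => c y b

theorem mem_set_inst_right (hG : InterpretsMul mulSym G) (δ : ParamFormula L G (Fin 1 ⊕ Fin k))
    (b : Fin (k + 1) → G) (x : G) :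
    x ∈ ((δ.right mulSym).inst b).set ↔ x * b (Fin.last k) ∈ (δ.inst (Fin.init b)).set := by
  rw [mem_set_inst, holds_right hG, mem_set_inst]
  rfl

theorem isNIP_left_inst_right (hG : InterpretsMul mulSym G)
    (h : ∀ b, ((δ.inst b).left mulSym).IsNIP) (b : Fin (k + 1) → G) :
    (((δ.right mulSym).inst b).left mulSym).IsNIP := by
  have hrel := (isNIP_left_iff hG _).1 (h (Fin.init b))
  simp only [isNIP_left_iff hG, mem_set_inst_right hG, mul_assoc]
  exact hrel.comap (· * b (Fin.last k)) id

theorem IsDeltaFormula.isNIP_left (hG : InterpretsMul mulSym G)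
    (h : ∀ b, ((δ.inst b).left mulSym).IsNIP) (hφ : δ.IsDeltaFormula φ) :
    (φ.left mulSym).IsNIP := by
  induction hφ with
  | inst b => exact h b
  | neg _ ih =>
    rw [isNIP_left_iff hG] at ih ⊢
    exact ih.not
  | conj _ _ ih₁ ih₂ =>
    rw [isNIP_left_iff hG] at ih₁ ih₂ ⊢
    simpa only [set_conj, Set.mem_inter_iff] using ih₁.and ih₂
  | disj _ _ ih₁ ih₂ =>
    rw [isNIP_left_iff hG] at ih₁ ih₂ ⊢
    simpa only [set_disj, Set.mem_union] using ih₁.or ih₂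

theorem isStableUnder_right_mul_right (hG : InterpretsMul mulSym G)
    (δ : ParamFormula L G (Fin 1 ⊕ Fin k)) (g : G) :
    (δ.right mulSym).IsStableUnder (· * g) := fun b =>
  ⟨Fin.snoc (α := fun _ => G) (Fin.init b) (g * b (Fin.last k)), Set.ext fun x => by
    simp [mem_set_inst_right hG, mul_assoc]⟩

theorem IsStableUnder.right_mul_left (hG : InterpretsMul mulSym G) {g : G}
    (h : δ.IsStableUnder (g * ·)) : (δ.right mulSym).IsStableUnder (g * ·) := fun b => by
  obtain ⟨c, hc⟩ := h (Fin.init b)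
  exact ⟨Fin.snoc (α := fun _ => G) c (b (Fin.last k)), Set.ext fun x => by
    simp [mem_set_inst_right hG, hc, mul_assoc]⟩

end ParamFormula

section UltrafilterTypes

variable {L : FirstOrder.Language.{u, v}} {G : Type w} [L.Structure G] {k : ℕ}
  {δ : ParamFormula L G (Fin 1 ⊕ Fin k)}

/-- The complete `δ`-type of an ultrafilter `F` on `G`: the sets defined by instances of `δ` or
their negations that belong to `F`. Every complete `δ`-type over `G` has this form. -/
def ultrafilterType (δ : ParamFormula L G (Fin 1 ⊕ Fin k)) (F : Ultrafilter G) : Set (Set G) :=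
  {X | IsInstanceSet δ X ∧ X ∈ F}

theorem IsInstanceSet.compl {X : Set G} (h : IsInstanceSet δ X) : IsInstanceSet δ Xᶜ := by
  obtain ⟨b, rfl | rfl⟩ := h
  · exact ⟨b, Or.inr rfl⟩
  · exact ⟨b, Or.inl (by rw [ParamFormula.set_neg, compl_compl])⟩

theorem IsInstanceSet.preimage {f : G → G} (hf : δ.IsStableUnder f) {X : Set G}
    (hX : IsInstanceSet δ X) : IsInstanceSet δ (f ⁻¹' X) := by
  obtain ⟨b, rfl | rfl⟩ := hX <;> obtain ⟨c, hc⟩ := hf b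
  · exact ⟨c, Or.inl hc.symm⟩
  · exact ⟨c, Or.inr (by rw [ParamFormula.set_neg, ParamFormula.set_neg, hc, Set.preimage_compl])⟩

theorem isConsistent_iff_neBot_generate {p : Set (Set G)} :
    IsConsistent p ↔ (Filter.generate p).NeBot :=
  Filter.generate_neBot_iff.symm

theorem inType_iff_mem_generate {φ : ParamFormula L G (Fin 1)} {p : Set (Set G)} :
    InType φ p ↔ φ.set ∈ Filter.generate p :=
  Filter.mem_generate_iff.symm

theorem le_generate_ultrafilterType (δ : ParamFormula L G (Fin 1 ⊕ Fin k)) (F : Ultrafilter G) :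
    ↑F ≤ Filter.generate (ultrafilterType δ F) :=
  Filter.le_generate_iff.2 fun _ hX => hX.2

theorem isConsistent_ultrafilterType (δ : ParamFormula L G (Fin 1 ⊕ Fin k)) (F : Ultrafilter G) :
    IsConsistent (ultrafilterType δ F) :=
  isConsistent_iff_neBot_generate.2 (F.neBot.mono (le_generate_ultrafilterType δ F))

theorem ultrafilterType_mem_typeSpace (δ : ParamFormula L G (Fin 1 ⊕ Fin k)) (F : Ultrafilter G) :
    ultrafilterType δ F ∈ typeSpace δ := by
  refine ⟨⟨fun X hX => hX.1, isConsistent_ultrafilterType δ F⟩,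
    fun q hq hle X hX => ⟨hq.1 X hX, ?_⟩⟩
  by_contra hXF
  have hXc : Xᶜ ∈ q := hle ⟨(hq.1 X hX).compl, Ultrafilter.compl_mem_iff_notMem.2 hXF⟩
  have := isConsistent_iff_neBot_generate.1 hq.2
  obtain ⟨x, hx, hxc⟩ := Filter.nonempty_of_mem (Filter.inter_mem
    (Filter.mem_generate_of_mem hX) (Filter.mem_generate_of_mem hXc))
  exact hxc hx

theorem mem_typeSpace_iff {p : Set (Set G)} :
    p ∈ typeSpace δ ↔ ∃ F : Ultrafilter G, p = ultrafilterType δ F := by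
  refine ⟨fun hp => ?_, fun ⟨F, hF⟩ => hF ▸ ultrafilterType_mem_typeSpace δ F⟩
  have := isConsistent_iff_neBot_generate.1 hp.1.2
  let F := Ultrafilter.of (Filter.generate p)
  have hsub : p ⊆ ultrafilterType δ F := fun X hX =>
    ⟨hp.1.1 X hX, Ultrafilter.of_le _ (Filter.mem_generate_of_mem hX)⟩
  exact ⟨F, hsub.antisymm (hp.2 ⟨fun X hX => hX.1, isConsistent_ultrafilterType δ F⟩ hsub)⟩

theorem ParamFormula.IsDeltaFormula.set_mem_generate_or_compl {φ : ParamFormula L G (Fin 1)}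
    (hφ : δ.IsDeltaFormula φ) (F : Ultrafilter G) :
    φ.set ∈ Filter.generate (ultrafilterType δ F) ∨
      φ.setᶜ ∈ Filter.generate (ultrafilterType δ F) := by
  induction hφ with
  | inst b =>
    have hb : IsInstanceSet δ (δ.inst b).set := ⟨b, Or.inl rfl⟩
    exact (F.mem_or_compl_mem _).imp (fun h => Filter.mem_generate_of_mem ⟨hb, h⟩)
      fun h => Filter.mem_generate_of_mem ⟨hb.compl, h⟩
  | neg _ ih =>
    rw [set_neg, compl_compl]
    exact ih.symm
  | conj _ _ ih₁ ih₂ =>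
    rw [set_conj, Set.compl_inter]
    rcases ih₁ with h₁ | h₁
    · exact ih₂.imp (Filter.inter_mem h₁) fun h₂ => Filter.mem_of_superset h₂ Set.subset_union_right
    · exact .inr (Filter.mem_of_superset h₁ Set.subset_union_left)
  | disj _ _ ih₁ ih₂ =>
    rw [set_disj, Set.compl_union]
    rcases ih₁ with h₁ | h₁
    · exact .inl (Filter.mem_of_superset h₁ Set.subset_union_left)
    · exact ih₂.imp (fun h₂ => Filter.mem_of_superset h₂ Set.subset_union_right)
        (Filter.inter_mem h₁)

theorem inType_ultrafilterType_iff {φ : ParamFormula L G (Fin 1)} (hφ : δ.IsDeltaFormula φ)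
    {F : Ultrafilter G} : InType φ (ultrafilterType δ F) ↔ φ.set ∈ F := by
  rw [inType_iff_mem_generate]
  refine ⟨fun h => le_generate_ultrafilterType δ F h, fun h => ?_⟩
  refine (hφ.set_mem_generate_or_compl F).resolve_right fun hc => ?_
  exact Ultrafilter.compl_mem_iff_notMem.1 (le_generate_ultrafilterType δ F hc) h

theorem image_preimage_ultrafilterType {e : G ≃ G} (he : δ.IsStableUnder e)
    (he' : δ.IsStableUnder e.symm) (F : Ultrafilter G) :
    (e ⁻¹' ·) '' ultrafilterType δ F = ultrafilterType δ (F.map e.symm) := by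
  ext X
  constructor
  · rintro ⟨X, ⟨hX, hXF⟩, rfl⟩
    exact ⟨hX.preimage he, by simpa [← Set.preimage_comp] using hXF⟩
  · rintro ⟨hX, hXF⟩
    exact ⟨e.symm ⁻¹' X, ⟨hX.preimage he', hXF⟩, by simp [← Set.preimage_comp]⟩

variable [Group G]

theorem isLeftGenericType_ultrafilterType_iff {F : Ultrafilter G} :
    IsLeftGenericType δ (ultrafilterType δ F) ↔
      ∀ φ, δ.IsDeltaFormula φ → φ.set ∈ F → IsLeftGeneric φ.set :=
  forall₂_congr fun _ hφ => imp_congr_left (inType_ultrafilterType_iff hφ)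

theorem isRightGenericType_ultrafilterType_iff {F : Ultrafilter G} :
    IsRightGenericType δ (ultrafilterType δ F) ↔
      ∀ φ, δ.IsDeltaFormula φ → φ.set ∈ F → IsRightGeneric φ.set :=
  forall₂_congr fun _ hφ => imp_congr_left (inType_ultrafilterType_iff hφ)

theorem IsLeftGenericType.image_preimage {p : Set (Set G)} (hp : p ∈ typeSpace δ)
    (hgen : IsLeftGenericType δ p) {e : G ≃ G} (he : δ.IsStableUnder e)
    (he' : δ.IsStableUnder e.symm) (hpre : ∀ X, IsLeftGeneric X → IsLeftGeneric (e ⁻¹' X)) :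
    (e ⁻¹' ·) '' p ∈ typeSpace δ ∧ IsLeftGenericType δ ((e ⁻¹' ·) '' p) := by
  obtain ⟨F, rfl⟩ := mem_typeSpace_iff.1 hp
  rw [isLeftGenericType_ultrafilterType_iff] at hgen
  rw [image_preimage_ultrafilterType he he', isLeftGenericType_ultrafilterType_iff]
  refine ⟨ultrafilterType_mem_typeSpace δ _, fun φ hφ hφF => ?_⟩
  obtain ⟨ψ, hψ, hψφ⟩ := hφ.exists_set_eq_preimage he'
  have hgenψ : IsLeftGeneric (e.symm ⁻¹' φ.set) := hψφ ▸ hgen ψ hψ (hψφ ▸ hφF)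
  simpa [← Set.preimage_comp] using hpre _ hgenψ

theorem IsLeftGenericType.leftTranslate {p : Set (Set G)} (hp : p ∈ typeSpace δ)
    (hgen : IsLeftGenericType δ p) (hδ : ∀ g : G, δ.IsStableUnder (g * ·)) (g : G) :
    leftTranslate g p ∈ typeSpace δ ∧ IsLeftGenericType δ (leftTranslate g p) :=
  hgen.image_preimage hp (e := (Equiv.mulLeft g).symm) (hδ g⁻¹) (hδ g)
    fun _ hX => hX.preimage_mul_left g⁻¹

theorem IsLeftGenericType.rightTranslate {p : Set (Set G)} (hp : p ∈ typeSpace δ)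
    (hgen : IsLeftGenericType δ p) (hδ : ∀ g : G, δ.IsStableUnder (· * g)) (g : G) :
    rightTranslate p g ∈ typeSpace δ ∧ IsLeftGenericType δ (rightTranslate p g) :=
  hgen.image_preimage hp (e := (Equiv.mulRight g).symm) (hδ g⁻¹) (hδ g)
    fun _ hX => hX.preimage_mul_right g⁻¹

end UltrafilterTypes

section GenericTypes

variable {L : FirstOrder.Language.{u, v}} {mulSym : L.Functions 2} {ι : Type w} {U : Ultrafilter ι}
  {A : ι → Type w'} [∀ i, Finite (A i)] [∀ i, L.Structure (A i)]
  {G : Type w''} [L.Structure G] [(countLang L).Structure G]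

theorem exists_ultrafilter_forall_mu_pos [∀ i, Nonempty (A i)]
    (hext : IsElementaryExtensionOfUltraproduct L U A G) :
    ∃ F : Ultrafilter G, ∀ φ : ParamFormula L G (Fin 1), φ.set ∈ F → 0 < mu φ := by
  let conull : Set (Set G) := {X | ∃ φ : ParamFormula L G (Fin 1), mu φ ≤ 0 ∧ φ.set = Xᶜ}
  have : (Filter.generate conull).NeBot := by
    refine Filter.generate_neBot_iff.2 fun t ht hfin => ?_
    by_contra hempty
    have := hfin.fintype
    choose φ hnull hφ using fun X : t => ht X.2
    have hcover : 1 ≤ ∑ X, mu (φ X) := by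
      refine one_le_sum_mu hext fun a => ?_
      by_contra! ha
      refine hempty ⟨a 0, fun X hX => not_not.1 fun hXa => ha ⟨X, hX⟩ ?_⟩
      rwa [ParamFormula.holds_iff_mem_set, hφ]
    exact one_pos.not_ge (hcover.trans (Finset.sum_nonpos fun X _ => hnull X))
  refine ⟨Ultrafilter.of (Filter.generate conull), fun φ hφ => ?_⟩
  by_contra! hnull
  have hc : φ.setᶜ ∈ Ultrafilter.of (Filter.generate conull) :=
    Ultrafilter.of_le _ (Filter.mem_generate_of_mem ⟨φ, hnull, (compl_compl _).symm⟩)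
  exact Ultrafilter.compl_mem_iff_notMem.1 hc hφ

theorem exists_mem_typeSpace_isGenericType [∀ i, Group (A i)] [Group G]
    (hA : ∀ i, InterpretsMul mulSym (A i)) (hG : InterpretsMul mulSym G)
    (hext : IsElementaryExtensionOfUltraproduct L U A G) {k : ℕ}
    {δ : ParamFormula L G (Fin 1 ⊕ Fin k)} (hδ : ∀ b, ((δ.inst b).left mulSym).IsNIP) :
    ∃ p ∈ typeSpace δ, IsLeftGenericType δ p ∧ IsRightGenericType δ p := by
  obtain ⟨F, hF⟩ := exists_ultrafilter_forall_mu_pos hext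
  refine ⟨_, ultrafilterType_mem_typeSpace δ F, isLeftGenericType_ultrafilterType_iff.2 ?_,
    isRightGenericType_ultrafilterType_iff.2 ?_⟩ <;> intro φ hφ hφF
  · exact (isLeftGeneric_iff_mu_pos hA hG hext (hφ.isNIP_left hG hδ)).2 (hF φ hφF)
  · exact (isRightGeneric_iff_mu_pos hA hG hext (hφ.isNIP_left hG hδ)).2 (hF φ hφF)

end GenericTypes

end PseudofiniteNIP

theorem proposition3p12
    {L : FirstOrder.Language} (mulSym : L.Functions 2)
    {ι : Type*} (U : Ultrafilter ι)
    (A : ι → Type*) [∀ i, Group (A i)] [∀ i, Finite (A i)] [∀ i, L.Structure (A i)]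
    (hA : ∀ i, InterpretsMul mulSym (A i))
    {G : Type*} [Group G] [L.Structure G] [(countLang L).Structure G]
    (hG : InterpretsMul mulSym G)
    (hext : IsElementaryExtensionOfUltraproduct L U A G) :
    (∀ φ : ParamFormula L G (Fin 1), (φ.left mulSym).IsNIP →
      (IsLeftGeneric φ.set ↔ IsRightGeneric φ.set) ∧ (IsRightGeneric φ.set ↔ 0 < mu φ)) ∧
    (∀ (k : ℕ) (δ : ParamFormula L G (Fin 1 ⊕ Fin k)), δ.IsLeftInvariant → δ.IsNIP →
      (∀ φ, (δ.right mulSym).IsDeltaFormula φ → (φ.left mulSym).IsNIP) ∧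
      (∀ φ, (δ.right mulSym).IsDeltaFormula φ →
        (IsLeftGeneric φ.set ↔ IsRightGeneric φ.set) ∧ (IsRightGeneric φ.set ↔ 0 < mu φ)) ∧
      (∀ p ∈ typeSpace (δ.right mulSym),
        (IsLeftGenericType (δ.right mulSym) p ↔ IsRightGenericType (δ.right mulSym) p) ∧
        (IsRightGenericType (δ.right mulSym) p ↔
          ∀ φ, (δ.right mulSym).IsDeltaFormula φ → InType φ p → 0 < mu φ)) ∧
      (∃ p ∈ typeSpace (δ.right mulSym), IsLeftGenericType (δ.right mulSym) p) ∧
      (∃ p ∈ typeSpace δ, IsLeftGenericType δ p ∧ IsRightGenericType δ p) ∧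
      (∀ p ∈ typeSpace (δ.right mulSym), IsLeftGenericType (δ.right mulSym) p → ∀ g : G,
        (leftTranslate g p ∈ typeSpace (δ.right mulSym) ∧
          IsLeftGenericType (δ.right mulSym) (leftTranslate g p)) ∧
        (rightTranslate p g ∈ typeSpace (δ.right mulSym) ∧
          IsLeftGenericType (δ.right mulSym) (rightTranslate p g)))) := by
  have hiff (φ : ParamFormula L G (Fin 1)) (hφ : (φ.left mulSym).IsNIP) :
      (IsLeftGeneric φ.set ↔ IsRightGeneric φ.set) ∧ (IsRightGeneric φ.set ↔ 0 < mu φ) :=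
    ⟨isLeftGeneric_iff_isRightGeneric hA hG hext hφ, isRightGeneric_iff_mu_pos hA hG hext hφ⟩
  refine ⟨hiff, fun k δ hinv hδ => ?_⟩
  have hinst := hinv.isNIP_left_inst hG hδ
  have hinst_right := ParamFormula.isNIP_left_inst_right hG hinst
  have hnip : ∀ φ, (δ.right mulSym).IsDeltaFormula φ → (φ.left mulSym).IsNIP :=
    fun φ hφ => hφ.isNIP_left hG hinst_right
  refine ⟨hnip, fun φ hφ => hiff φ (hnip φ hφ), fun p _ => ⟨?_, ?_⟩, ?_, ?_,
    fun p hp hgen g => ⟨?_, ?_⟩⟩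
  · exact forall₃_congr fun φ hφ _ => (hiff φ (hnip φ hφ)).1
  · exact forall₃_congr fun φ hφ _ => (hiff φ (hnip φ hφ)).2
  · obtain ⟨p, hp, hgen, -⟩ := exists_mem_typeSpace_isGenericType hA hG hext hinst_right
    exact ⟨p, hp, hgen⟩
  · exact exists_mem_typeSpace_isGenericType hA hG hext hinst
  · exact hgen.leftTranslate hp (fun g => (hinv.isStableUnder g).right_mul_left hG) g
  · exact hgen.rightTranslate hp (ParamFormula.isStableUnder_right_mul_right hG δ) g
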